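/- Let $T\ge 1$ be an integer and let $U_T$ be the set of all pairs $(a,b)\in\mathbb{R}^2$ for which the trinomial $F(z)=z+a z^{1+T}+b z^{1+2T}$ is univalent (injective) in the open unit disk $\{z\in\mathbb{C}:|z|<1\}$. Put $$a^{(0)}=2\,\frac{1+T}{1+2T}\,\sin\frac{\pi}{2+2T},\qquad b^{(0)}=\frac{1}{1+2T}.$$ Then $(a^{(0)},b^{(0)})$ belongs to $U_T$ and is its upper right corner, that is, $x\le a^{(0)}$ and $y\le b^{(0)}$ for all $(x,y)\in U_T$. Moreover $1+x+y>0$ for all $(x,y)\in U_T$, and over $U_T$ the functions $$L_1(x,y)=x,\qquad L_2(x,y)=1+x+y$$ attain their maximum, and the function $$L_3(x,y)=\frac{1-x+y}{1+x+y}$$ attains its minimum, at the point $(a^{(0)},b^{(0)})$. -/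

import Mathlib

noncomputable section

/-- The trinomial `F(z) = z + a z^(1+T) + b z^(1+2T)` with real coefficients `a`, `b`. -/
def trinomial (T : ℕ) (a b : ℝ) (z : ℂ) : ℂ :=
  z + (a : ℂ) * z ^ (1 + T) + (b : ℂ) * z ^ (1 + 2 * T)

/-- The region `U_T` of real pairs `(a, b)` for which the trinomial is univalent in the open
unit disk. The trinomial is a polynomial, hence holomorphic, so univalence is injectivity. -/
def univalenceRegion (T : ℕ) : Set (ℝ × ℝ) :=
  {p | Set.InjOn (trinomial T p.1 p.2) (Metric.ball (0 : ℂ) 1)}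

/-- `a⁽⁰⁾ = 2 (1+T)/(1+2T) sin(π/(2+2T))`. -/
def cornerA (T : ℕ) : ℝ :=
  2 * ((1 + (T : ℝ)) / (1 + 2 * (T : ℝ))) * Real.sin (Real.pi / (2 + 2 * (T : ℝ)))

/-- `b⁽⁰⁾ = 1/(1+2T)`. -/
def cornerB (T : ℕ) : ℝ := 1 / (1 + 2 * (T : ℝ))

/-- The point `(a⁽⁰⁾, b⁽⁰⁾)`. -/
def corner (T : ℕ) : ℝ × ℝ := (cornerA T, cornerB T)

/-- `L₁(x, y) = x`. -/
def L₁ (p : ℝ × ℝ) : ℝ := p.1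

/-- `L₂(x, y) = 1 + x + y`. -/
def L₂ (p : ℝ × ℝ) : ℝ := 1 + p.1 + p.2

/-- `L₃(x, y) = (1 - x + y)/(1 + x + y)`. -/
def L₃ (p : ℝ × ℝ) : ℝ := (1 - p.1 + p.2) / (1 + p.1 + p.2)

end

/-!
If two distinct points of equal modulus are written `z e^{±iθ}`, then for a polynomial `f = ∑ aₖ zᵏ`
the difference `f (z e^{iθ}) - f (z e^{-iθ})` is `2 i z sin θ` times Dieudonné's sum
`∑ aₖ (sin kθ / sin θ) zᵏ⁻¹`, which becomes `f' z` at `θ = 0`. A locally injective open map of the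
disk which is not injective already identifies two points of equal modulus, so `f` is univalent as
soon as none of these sums vanishes. For the trinomial the sum is a real quadratic in `z ^ T`, and
the Schur–Cohn conditions turn univalence into inequalities in `(a, b)`, one pair for every
`x = cos θ`:
`b U_{2T}(x) ≤ 1` and `|a U_T(x)| ≤ 1 + b U_{2T}(x)`.

At `x = 1` these give `-1 < b ≤ b⁽⁰⁾`, and at `θ = π / (2 + 2T)`, where `sin (1 + T)θ = 1` and
`sin (1 + 2T)θ = sin θ`, they give `|a| ≤ (1 + b) sin (π / (2 + 2T))`, with equality at the corner;
all the extremal claims follow. That the corner itself satisfies the inequalities for every `θ`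
reduces, with `n = T + 1`, to
`n sin (π / 2n) |sin nθ| ≤ (n - 1) sin θ + sin nθ cos (n - 1)θ`, which is proved on each arch of
`|sin nθ|` by comparison with the centre of the arch.
-/

open Polynomial hiding trinomial
open Filter Metric Polynomial.Chebyshev Real Set Topology

theorem isCompact_setOf_eq_and_ne {X Y : Type*} [TopologicalSpace X] [TopologicalSpace Y]
    [T2Space Y] {f : X → Y} {K : Set X} (hK : IsCompact K) (hf : ContinuousOn f K)
    (hinj : ∀ x ∈ K, ∃ U ∈ 𝓝[K] x, InjOn f U) :
    IsCompact {p : X × X | p ∈ K ×ˢ K ∧ f p.1 = f p.2 ∧ p.1 ≠ p.2} := by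
  refine isCompact_iff_ultrafilter_le_nhds.2 fun F hF => ?_
  have hFS : ∀ᶠ p in (F : Filter (X × X)), p ∈ K ×ˢ K ∧ f p.1 = f p.2 ∧ p.1 ≠ p.2 :=
    le_principal_iff.1 hF
  obtain ⟨⟨x, y⟩, ⟨hx, hy⟩, hxy⟩ := isCompact_iff_ultrafilter_le_nhds.1 (hK.prod hK) F
    (le_principal_iff.2 (hFS.mono fun p hp => hp.1))
  have hfst : Tendsto Prod.fst (F : Filter (X × X)) (𝓝[K] x) :=
    tendsto_nhdsWithin_iff.2 ⟨(continuous_fst.tendsto (x, y)).mono_left hxy,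
      hFS.mono fun p hp => hp.1.1⟩
  have hsnd : Tendsto Prod.snd (F : Filter (X × X)) (𝓝[K] y) :=
    tendsto_nhdsWithin_iff.2 ⟨(continuous_snd.tendsto (x, y)).mono_left hxy,
      hFS.mono fun p hp => hp.1.2⟩
  refine ⟨(x, y), ⟨⟨hx, hy⟩, ?_, ?_⟩, hxy⟩
  · exact tendsto_nhds_unique_of_eventuallyEq ((hf x hx).tendsto.comp hfst)
      ((hf y hy).tendsto.comp hsnd) (hFS.mono fun p hp => hp.2.1)
  · intro hxy_eq
    obtain rfl : x = y := hxy_eq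
    obtain ⟨U, hU, hUinj⟩ := hinj x hx
    obtain ⟨p, ⟨hp, hp1⟩, hp2⟩ := ((hFS.and (hfst hU)).and (hsnd hU)).exists
    exact hp.2.2 (hUinj hp1 hp2 hp.2.1)

section SphereCriterion

variable {E Y : Type*} [NormedAddCommGroup E] [NormedSpace ℝ E] [TopologicalSpace Y] {f : E → Y}

theorem exists_eq_and_norm_lt_norm_lt {z w : E} (hz : 𝓝 (f z) ≤ map f (𝓝 z))
    (hw : ContinuousAt f w) (hfzw : f z = f w) (hzw : ‖z‖ < ‖w‖) :
    ∃ u v, f u = f v ∧ ‖u‖ < ‖v‖ ∧ ‖v‖ < ‖w‖ := by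
  obtain ⟨r, hzr, hrw⟩ := exists_between hzw
  have himage : f '' {u | ‖u‖ < r} ∈ 𝓝 (f w) :=
    hfzw ▸ hz (image_mem_map (continuous_norm.continuousAt.eventually_lt_const hzr))
  have hradial : Tendsto (fun t : ℝ => t • w) (𝓝[<] 1) (𝓝 w) := by
    have : Continuous fun t : ℝ => t • w := by fun_prop
    simpa only [one_smul] using (this.tendsto 1).mono_left nhdsWithin_le_nhds
  have hnorm : ∀ᶠ t : ℝ in 𝓝[<] 1, r < ‖t • w‖ := hradial.norm.eventually_const_lt hrw
  have hIoo : ∀ᶠ t : ℝ in 𝓝[<] 1, t ∈ Ioo (0 : ℝ) 1 := Ioo_mem_nhdsLT zero_lt_one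
  obtain ⟨t, ⟨⟨u, hu, hfu⟩, hrt⟩, ht⟩ :=
    (((hw.tendsto.comp hradial).eventually_mem himage).and hnorm |>.and hIoo).exists
  refine ⟨u, t • w, hfu, lt_trans hu hrt, ?_⟩
  rw [norm_smul, Real.norm_of_nonneg ht.1.le]
  exact mul_lt_of_lt_one_left ((norm_nonneg z).trans_lt hzw) ht.2

-- Among the coincidences `f z = f w` with `z ≠ w` take one minimizing `max ‖z‖ ‖w‖`. If the norms
-- differed, openness of `f` at the smaller point would let the larger one be pulled inwards.
theorem injOn_ball_of_injOn_sphere [ProperSpace E] [T2Space Y] {R : ℝ}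
    (hf : ContinuousOn f (ball 0 R)) (hinj : ∀ z ∈ ball (0 : E) R, ∃ U ∈ 𝓝 z, InjOn f U)
    (hopen : ∀ z ∈ ball (0 : E) R, 𝓝 (f z) ≤ map f (𝓝 z))
    (hsphere : ∀ r < R, InjOn f (sphere 0 r)) : InjOn f (ball 0 R) := by
  intro z₀ hz₀ w₀ hw₀ hfzw₀
  by_contra hne₀
  obtain ⟨M, hM⟩ : ∃ M, M = max ‖z₀‖ ‖w₀‖ := ⟨_, rfl⟩
  have hMR : M < R := hM ▸ max_lt (mem_ball_zero_iff.1 hz₀) (mem_ball_zero_iff.1 hw₀)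
  have hsub : closedBall (0 : E) M ⊆ ball 0 R := closedBall_subset_ball hMR
  have hcompact := isCompact_setOf_eq_and_ne (isCompact_closedBall (0 : E) M) (hf.mono hsub)
    fun z hz => (hinj z (hsub hz)).imp fun U hU => ⟨mem_nhdsWithin_of_mem_nhds hU.1, hU.2⟩
  obtain ⟨⟨z, w⟩, ⟨⟨hz, hw⟩, hfzw, hne⟩, hmin⟩ := hcompact.exists_isMinOn
    ⟨(z₀, w₀), ⟨⟨by simp [hM], by simp [hM]⟩, hfzw₀, hne₀⟩⟩ continuous_norm.continuousOn
  replace hmin : ∀ u v, ‖u‖ ≤ M → ‖v‖ ≤ M → f u = f v → u ≠ v → max ‖z‖ ‖w‖ ≤ max ‖u‖ ‖v‖ :=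
    fun u v hu hv hfuv huv => isMinOn_iff.1 hmin (u, v)
      ⟨⟨mem_closedBall_zero_iff.2 hu, mem_closedBall_zero_iff.2 hv⟩, hfuv, huv⟩
  wlog hle : ‖z‖ ≤ ‖w‖ generalizing z w
  · exact this w z hw hz hfzw.symm hne.symm (by simpa only [max_comm ‖w‖] using hmin)
      (le_of_not_ge hle)
  rcases hle.eq_or_lt with heq | hlt
  · exact hne (hsphere ‖w‖ ((mem_closedBall_zero_iff.1 hw).trans_lt hMR) (by simpa using heq)
      (by simp) hfzw)
  · obtain ⟨u, v, hfuv, huv, hvw⟩ := exists_eq_and_norm_lt_norm_lt (hopen z (hsub hz))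
      (hf.continuousAt (isOpen_ball.mem_nhds (hsub hw))) hfzw hlt
    have hvM : ‖v‖ ≤ M := hvw.le.trans (mem_closedBall_zero_iff.1 hw)
    have := hmin u v (huv.le.trans hvM) hvM hfuv (fun h => huv.ne (congrArg norm h))
    rw [max_eq_right hle, max_eq_right huv.le] at this
    exact this.not_gt hvw

end SphereCriterion

theorem injOn_ball_of_deriv_ne_zero_of_injOn_sphere {f : ℂ → ℂ} {R : ℝ}
    (hf : DifferentiableOn ℂ f (ball 0 R)) (hderiv : ∀ z ∈ ball 0 R, deriv f z ≠ 0)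
    (hsphere : ∀ r < R, InjOn f (sphere 0 r)) : InjOn f (ball 0 R) := by
  have hstrict : ∀ z ∈ ball 0 R, HasStrictDerivAt f (deriv f z) z := fun z hz =>
    (hf.analyticAt (isOpen_ball.mem_nhds hz)).hasStrictDerivAt
  refine injOn_ball_of_injOn_sphere hf.continuousOn (fun z hz => ?_)
    (fun z hz => ((hstrict z hz).map_nhds_eq (hderiv z hz)).ge) hsphere
  exact ⟨_, (hstrict z hz).eventually_left_inverse (hderiv z hz), LeftInvOn.injOn fun _ => id⟩

/-- Dieudonné's sum `∑ aₖ (sin kθ / sin θ) zᵏ⁻¹` of the polynomial `f = ∑ aₖ zᵏ` at `x = cos θ`,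
whose zeros detect coincidences of `f` at two points of equal modulus. Writing the quotient of sines
as the Chebyshev polynomial `U (k - 1)` gives it a value at `x = ±1` as well; the truncated exponent
at `k = 0` is harmless because `U (-1) = 0`. -/
noncomputable def dieudonneSum (f : ℂ[X]) (x : ℝ) (z : ℂ) : ℂ :=
  f.sum fun k c => c * (U ℝ (k - 1)).eval x * z ^ (k - 1)

theorem dieudonneSum_one (f : ℂ[X]) (z : ℂ) : dieudonneSum f 1 z = f.derivative.eval z := by
  simp [dieudonneSum, derivative_eval]

theorem pow_mul_exp_sub_pow_mul_exp_neg (z : ℂ) (θ : ℝ) (k : ℕ) :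
    (z * Complex.exp (θ * Complex.I)) ^ k - (z * Complex.exp (-θ * Complex.I)) ^ k =
      2 * Complex.I * z * sin θ * ((U ℝ (k - 1)).eval (cos θ) * z ^ (k - 1)) := by
  have hU : (sin (k * θ) : ℂ) = (U ℝ (k - 1)).eval (cos θ) * sin θ := by
    have := U_real_cos θ (k - 1)
    push_cast [sub_add_cancel] at this
    exact_mod_cast this.symm
  have hexp : Complex.exp (k * (θ * Complex.I)) - Complex.exp (k * (-θ * Complex.I)) =
      2 * Complex.I * sin (k * θ) := by
    rw [← mul_assoc, ← mul_assoc, mul_neg, Complex.exp_mul_I, Complex.exp_mul_I, Complex.cos_neg,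
      Complex.sin_neg]
    push_cast
    ring
  rcases k with _ | k
  · simp
  · rw [mul_pow, mul_pow, ← Complex.exp_nat_mul, ← Complex.exp_nat_mul, ← mul_sub, hexp, hU,
      Nat.add_sub_cancel]
    ring

theorem eval_mul_exp_sub_eval_mul_exp_neg (f : ℂ[X]) (z : ℂ) (θ : ℝ) :
    f.eval (z * Complex.exp (θ * Complex.I)) - f.eval (z * Complex.exp (-θ * Complex.I)) =
      2 * Complex.I * z * sin θ * dieudonneSum f (cos θ) z := by
  rw [eval_eq_sum, eval_eq_sum, dieudonneSum, Polynomial.sum, Polynomial.sum, Polynomial.sum,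
    ← Finset.sum_sub_distrib, Finset.mul_sum]
  refine Finset.sum_congr rfl fun k _ => ?_
  rw [← mul_sub, pow_mul_exp_sub_pow_mul_exp_neg]
  ring

theorem exists_eq_mul_exp_of_norm_eq {z w : ℂ} (hzw : ‖z‖ = ‖w‖) (hne : z ≠ w) :
    ∃ (v : ℂ) (θ : ℝ), sin θ ≠ 0 ∧ ‖v‖ = ‖w‖ ∧ z = v * Complex.exp (θ * Complex.I) ∧
      w = v * Complex.exp (-θ * Complex.I) := by
  obtain ⟨θ, hθ⟩ : ∃ θ, θ = (z.arg - w.arg) / 2 := ⟨_, rfl⟩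
  obtain ⟨v, hv⟩ : ∃ v, v = ‖w‖ * Complex.exp (((z.arg + w.arg) / 2 : ℝ) * Complex.I) := ⟨_, rfl⟩
  have hz : z = v * Complex.exp (θ * Complex.I) := by
    conv_lhs => rw [← Complex.norm_mul_exp_arg_mul_I z]
    rw [hzw, hv, hθ, mul_assoc, ← Complex.exp_add]
    congr 2
    push_cast
    ring
  have hw : w = v * Complex.exp (-θ * Complex.I) := by
    conv_lhs => rw [← Complex.norm_mul_exp_arg_mul_I w]
    rw [hv, hθ, mul_assoc, ← Complex.exp_add]
    congr 2
    push_cast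
    ring
  have hθ_ne : θ ≠ 0 := by
    intro h
    exact hne (by rw [hz, hw, h]; simp)
  refine ⟨v, θ, ?_, ?_, hz, hw⟩
  · rwa [ne_eq, sin_eq_zero_iff_of_lt_of_lt] <;>
      linarith [z.arg_le_pi, z.neg_pi_lt_arg, w.arg_le_pi, w.neg_pi_lt_arg]
  · rw [hv, norm_mul, Complex.norm_exp_ofReal_mul_I, mul_one,
      Complex.norm_real, norm_norm]

theorem injOn_ball_of_dieudonneSum_ne_zero {f : ℂ[X]} {R : ℝ}
    (h : ∀ x ∈ Icc (-1) 1, ∀ z ∈ ball 0 R, dieudonneSum f x z ≠ 0) :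
    InjOn (fun z => f.eval z) (ball 0 R) := by
  refine injOn_ball_of_deriv_ne_zero_of_injOn_sphere f.differentiable.differentiableOn ?_ ?_
  · intro z hz
    rw [Polynomial.deriv, ← dieudonneSum_one]
    exact h 1 (by simp) z hz
  · intro r hr z hz w hw hfzw
    rw [mem_sphere_zero_iff_norm] at hz hw
    by_contra hne
    obtain ⟨v, θ, hθ, hvw, rfl, rfl⟩ := exists_eq_mul_exp_of_norm_eq (hz.trans hw.symm) hne
    have hv : v ≠ 0 := by
      rintro rfl
      simp at hne
    have hv_mem : v ∈ ball 0 R := by rwa [mem_ball_zero_iff, hvw, hw]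
    have hsum := h (cos θ) ⟨neg_one_le_cos θ, cos_le_one θ⟩ v hv_mem
    have hsub := eval_mul_exp_sub_eval_mul_exp_neg f v θ
    rw [sub_eq_zero.2 hfzw] at hsub
    have hsin : (sin θ : ℂ) ≠ 0 := Complex.ofReal_ne_zero.2 hθ
    have hfactor : 2 * Complex.I * v * sin θ ≠ 0 :=
      mul_ne_zero (mul_ne_zero (mul_ne_zero two_ne_zero Complex.I_ne_zero) hv) hsin
    exact mul_ne_zero hfactor hsum hsub.symm

theorem dieudonneSum_ne_zero_of_injOn_ball {f : ℂ[X]} {R : ℝ}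
    (h : InjOn (fun z => f.eval z) (ball 0 R)) {θ : ℝ} (hθ : sin θ ≠ 0) {z : ℂ}
    (hz : z ∈ ball 0 R) (hz0 : z ≠ 0) : dieudonneSum f (cos θ) z ≠ 0 := by
  intro hsum
  have hsub := eval_mul_exp_sub_eval_mul_exp_neg f z θ
  rw [hsum, mul_zero, sub_eq_zero] at hsub
  have hexp := h (by simpa [Complex.norm_exp] using hz) (by simpa [Complex.norm_exp] using hz) hsub
  have hpow := pow_mul_exp_sub_pow_mul_exp_neg z θ 1
  rw [hexp, sub_self] at hpow
  simp [hz0, Complex.ofReal_ne_zero.2 hθ, -Complex.ofReal_sin] at hpow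

theorem quadratic_pos_of_abs_lt_one {p q r t : ℝ} (hr : r ≤ p) (hq : |q| ≤ p + r) (hp : 0 < p)
    (ht : |t| < 1) : 0 < p + q * t + r * t ^ 2 := by
  have ht0 := abs_nonneg t
  have hfactor : 0 < (1 - |t|) * (p - r * |t|) := by
    apply mul_pos <;> nlinarith
  have hqt : -((p + r) * |t|) ≤ q * t :=
    (neg_le_neg (by rw [abs_mul]; gcongr)).trans (neg_abs_le (q * t))
  rw [← sq_abs t]
  linarith

theorem one_le_norm_of_quadratic_eq_zero {p q r : ℝ} (hr : r ≤ p) (hq : |q| ≤ p + r) (hp : 0 < p)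
    {w : ℂ} (hw : (p : ℂ) + q * w + r * w ^ 2 = 0) : 1 ≤ ‖w‖ := by
  by_contra! hlt
  have hre := congrArg Complex.re hw
  have him := congrArg Complex.im hw
  simp only [pow_two, Complex.add_re, Complex.add_im, Complex.mul_re, Complex.mul_im,
    Complex.ofReal_re, Complex.ofReal_im, Complex.zero_re, Complex.zero_im] at hre him
  by_cases hreal : w.im = 0
  · have hpos := quadratic_pos_of_abs_lt_one hr hq hp ((Complex.abs_re_le_norm w).trans_lt hlt)
    rw [hreal] at hre
    linarith
  · have hsum : q = -(2 * r * w.re) := mul_right_cancel₀ hreal (by linarith)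
    have hprod : p = r * ‖w‖ ^ 2 := by
      rw [← Complex.normSq_eq_norm_sq, Complex.normSq_apply]
      rw [hsum] at hre
      linarith
    have hsq : ‖w‖ ^ 2 < 1 := pow_lt_one₀ (norm_nonneg w) hlt two_ne_zero
    nlinarith [mul_le_mul_of_nonneg_right hr (sq_nonneg ‖w‖)]

theorem le_of_forall_quadratic_ne_zero {p q r : ℝ} (hp : 0 < p)
    (h : ∀ w ∈ ball (0 : ℂ) 1, (p : ℂ) + q * w + r * w ^ 2 ≠ 0) : r ≤ p := by
  by_contra! hlt
  have hr0 : (r : ℂ) ≠ 0 := Complex.ofReal_ne_zero.2 (hp.trans hlt).ne'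
  have hp0 : (p : ℂ) ≠ 0 := Complex.ofReal_ne_zero.2 hp.ne'
  obtain ⟨w, hw⟩ := exists_quadratic_eq_zero (b := (q : ℂ)) (c := p) hr0
    (IsAlgClosed.exists_eq_mul_self _)
  have hw0 : w ≠ 0 := by
    rintro rfl
    exact hp0 (by simpa using hw)
  have hw_norm : 1 ≤ ‖w‖ := by
    by_contra! hlt
    exact h w (mem_ball_zero_iff.2 hlt) (by linear_combination hw)
  refine h (p / (r * w)) (mem_ball_zero_iff.2 ?_) ?_
  · rw [norm_div, norm_mul, Complex.norm_real, Complex.norm_real, norm_of_nonneg hp.le,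
      norm_of_nonneg (hp.trans hlt).le, div_lt_one (by nlinarith)]
    nlinarith
  · field_simp
    linear_combination (p : ℂ) * hw

theorem abs_le_of_forall_quadratic_ne_zero {p q r : ℝ} (hp : 0 < p)
    (h : ∀ w ∈ ball (0 : ℂ) 1, (p : ℂ) + q * w + r * w ^ 2 ≠ 0) : |q| ≤ p + r := by
  have hreal : ∀ t : ℝ, |t| < 1 → p + q * t + r * t ^ 2 ≠ 0 := fun t ht h0 =>
    h t (by simpa using ht) (by exact_mod_cast h0)
  have hend : ∀ ε : ℝ, |ε| = 1 → 0 ≤ p + q * ε + r := by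
    intro ε hε
    by_contra! hneg
    have hcont : ContinuousOn (fun t : ℝ => p + q * (ε * t) + r * (ε * t) ^ 2) (Icc 0 1) := by
      fun_prop
    obtain ⟨t, ht, ht0⟩ := intermediate_value_Ioo' zero_le_one hcont
      (show (0 : ℝ) ∈ Ioo _ _ by simpa [mul_pow, ← sq_abs ε, hε] using ⟨hneg, hp⟩)
    refine hreal (ε * t) ?_ ht0
    rw [abs_mul, hε, one_mul, abs_of_pos ht.1]
    exact ht.2
  have hone := hend 1 (by simp)
  have hneg_one := hend (-1) (by simp)
  rw [abs_le]
  constructor <;> linarith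

theorem forall_quadratic_ne_zero_iff {p q r : ℝ} (hp : 0 < p) :
    (∀ w ∈ ball (0 : ℂ) 1, (p : ℂ) + q * w + r * w ^ 2 ≠ 0) ↔ r ≤ p ∧ |q| ≤ p + r :=
  ⟨fun h => ⟨le_of_forall_quadratic_ne_zero hp h, abs_le_of_forall_quadratic_ne_zero hp h⟩,
    fun ⟨hr, hq⟩ _ hw h0 => (mem_ball_zero_iff.1 hw).not_ge
      (one_le_norm_of_quadratic_eq_zero hr hq hp h0)⟩

theorem abs_eval_U_le (n : ℕ) {x : ℝ} (hx : x ∈ Icc (-1) 1) : |(U ℝ n).eval x| ≤ n + 1 := by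
  have hx1 : |x| ≤ 1 := abs_le.2 hx
  induction n with
  | zero => simp
  | succ n ih =>
    have hT := abs_eval_T_real_le_one (n + 1) hx1
    push_cast
    rw [U_eq_X_mul_U_add_T, eval_add, eval_mul, eval_X]
    calc |x * (U ℝ n).eval x + (T ℝ (n + 1)).eval x|
        ≤ |x| * |(U ℝ n).eval x| + |(T ℝ (n + 1)).eval x| := by
          rw [← abs_mul]
          exact abs_add_le _ _
      _ ≤ 1 * (n + 1) + 1 := by gcongr
      _ = n + 1 + 1 := by ring

theorem abs_sin_nat_mul_le (n : ℕ) (θ : ℝ) : |sin (n * θ)| ≤ n * |sin θ| := by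
  rcases n with _ | n
  · simp
  · have hU := U_real_cos θ n
    push_cast at hU ⊢
    rw [← hU, abs_mul]
    gcongr
    exact abs_eval_U_le n ⟨neg_one_le_cos θ, cos_le_one θ⟩

theorem le_on_Icc_of_comp_cos_le {f g : ℝ → ℝ} (hf : Continuous f) (hg : Continuous g)
    (h : ∀ θ ∈ Ioo 0 π, f (cos θ) ≤ g (cos θ)) {x : ℝ} (hx : x ∈ Icc (-1) 1) : f x ≤ g x := by
  have harccos : arccos x ∈ closure (Ioo 0 π) := by
    rw [closure_Ioo pi_pos.ne]
    exact ⟨arccos_nonneg x, arccos_le_pi x⟩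
  have := le_on_closure h (hf.comp continuous_cos).continuousOn
    (hg.comp continuous_cos).continuousOn harccos
  simpa only [Function.comp_apply, cos_arccos hx.1 hx.2] using this

/-- The function `trinomial T a b` as a polynomial, to which Dieudonné's sum applies. -/
noncomputable def trinomialPolynomial (T : ℕ) (a b : ℝ) : ℂ[X] :=
  X + C (a : ℂ) * X ^ (1 + T) + C (b : ℂ) * X ^ (1 + 2 * T)

theorem eval_trinomialPolynomial (T : ℕ) (a b : ℝ) (z : ℂ) :
    (trinomialPolynomial T a b).eval z = trinomial T a b z := by
  simp [trinomialPolynomial, trinomial]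

theorem dieudonneSum_add (f g : ℂ[X]) (x : ℝ) (z : ℂ) :
    dieudonneSum (f + g) x z = dieudonneSum f x z + dieudonneSum g x z :=
  sum_add_index f g _ (by simp) (by intros; ring)

theorem dieudonneSum_C_mul_X_pow (c : ℂ) (n : ℕ) (x : ℝ) (z : ℂ) :
    dieudonneSum (C c * X ^ n) x z = c * (U ℝ (n - 1)).eval x * z ^ (n - 1) := by
  rw [dieudonneSum, C_mul_X_pow_eq_monomial, sum_monomial_index]
  simp

theorem dieudonneSum_trinomialPolynomial (T : ℕ) (a b x : ℝ) (z : ℂ) :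
    dieudonneSum (trinomialPolynomial T a b) x z =
      (1 : ℝ) + (a * (U ℝ T).eval x : ℝ) * z ^ T +
        (b * (U ℝ (2 * T)).eval x : ℝ) * (z ^ T) ^ 2 := by
  have hX : dieudonneSum X x z = 1 := by
    simpa using dieudonneSum_C_mul_X_pow 1 1 x z
  rw [trinomialPolynomial, dieudonneSum_add, dieudonneSum_add, hX, dieudonneSum_C_mul_X_pow,
    dieudonneSum_C_mul_X_pow]
  push_cast
  simp only [add_sub_cancel_left, Nat.add_sub_cancel_left]
  ring

theorem mem_univalenceRegion_iff_injOn_eval {T : ℕ} {p : ℝ × ℝ} : p ∈ univalenceRegion T ↔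
    InjOn (fun z => (trinomialPolynomial T p.1 p.2).eval z) (ball 0 1) := by
  simp only [eval_trinomialPolynomial]
  rfl

theorem mem_univalenceRegion_of_forall_le {T : ℕ} (hT : T ≠ 0) {p : ℝ × ℝ}
    (h : ∀ x ∈ Icc (-1) 1, p.2 * (U ℝ (2 * T)).eval x ≤ 1 ∧
      |p.1 * (U ℝ T).eval x| ≤ 1 + p.2 * (U ℝ (2 * T)).eval x) : p ∈ univalenceRegion T := by
  refine mem_univalenceRegion_iff_injOn_eval.2
    (injOn_ball_of_dieudonneSum_ne_zero fun x hx z hz => ?_)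
  rw [dieudonneSum_trinomialPolynomial]
  refine (forall_quadratic_ne_zero_iff one_pos).2 (h x hx) (z ^ T) ?_
  rw [mem_ball_zero_iff] at hz ⊢
  rw [norm_pow]
  exact pow_lt_one₀ (norm_nonneg z) hz hT

theorem eval_U_cos_le_of_mem_univalenceRegion {T : ℕ} (hT : T ≠ 0) {p : ℝ × ℝ}
    (hp : p ∈ univalenceRegion T) {θ : ℝ} (hθ : sin θ ≠ 0) :
    p.2 * (U ℝ (2 * T)).eval (cos θ) ≤ 1 ∧
      |p.1 * (U ℝ T).eval (cos θ)| ≤ 1 + p.2 * (U ℝ (2 * T)).eval (cos θ) := by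
  refine (forall_quadratic_ne_zero_iff one_pos).1 fun w hw => ?_
  obtain ⟨z, rfl⟩ := IsAlgClosed.exists_pow_nat_eq w (Nat.pos_of_ne_zero hT)
  rcases eq_or_ne z 0 with rfl | hz0
  · simp [hT]
  · rw [← dieudonneSum_trinomialPolynomial]
    refine dieudonneSum_ne_zero_of_injOn_ball (mem_univalenceRegion_iff_injOn_eval.1 hp) hθ ?_ hz0
    rw [mem_ball_zero_iff] at hw ⊢
    rw [norm_pow] at hw
    exact (pow_lt_one_iff_of_nonneg (norm_nonneg z) hT).1 hw

theorem mem_univalenceRegion_iff {T : ℕ} (hT : T ≠ 0) {p : ℝ × ℝ} : p ∈ univalenceRegion T ↔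
    ∀ x ∈ Icc (-1) 1, p.2 * (U ℝ (2 * T)).eval x ≤ 1 ∧
      |p.1 * (U ℝ T).eval x| ≤ 1 + p.2 * (U ℝ (2 * T)).eval x := by
  refine ⟨fun hp x hx => ?_, mem_univalenceRegion_of_forall_le hT⟩
  have hcos := fun θ (hθ : θ ∈ Ioo 0 π) =>
    eval_U_cos_le_of_mem_univalenceRegion hT hp (sin_pos_of_mem_Ioo hθ).ne'
  constructor
  · exact le_on_Icc_of_comp_cos_le (f := fun x => p.2 * (U ℝ (2 * T)).eval x) (by fun_prop)
      continuous_const (fun θ hθ => (hcos θ hθ).1) hx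
  · exact le_on_Icc_of_comp_cos_le (f := fun x => |p.1 * (U ℝ T).eval x|)
      (g := fun x => 1 + p.2 * (U ℝ (2 * T)).eval x) (by fun_prop) (by fun_prop)
      (fun θ hθ => (hcos θ hθ).2) hx

theorem hasDerivAt_lobe {n σ x : ℝ} (hx : cos (n * x) ≠ 0) :
    HasDerivAt (fun x => (n - 1) * sin (σ + x) / cos (n * x) + sin (σ + x - n * x))
      ((n - 1) * sin (n * x) * (n * sin (σ + x) - cos (n * x) * sin (σ + x - n * x)) /
        cos (n * x) ^ 2) x := by
  have hadd : HasDerivAt (fun x : ℝ => σ + x) 1 x := (hasDerivAt_id x).const_add σ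
  have hmul : HasDerivAt (fun x : ℝ => n * x) n x := by
    simpa using (hasDerivAt_id x).const_mul n
  refine (((hadd.sin.const_mul (n - 1)).div hmul.cos hx).add (hadd.fun_sub hmul).sin).congr_deriv ?_
  rw [sin_sub, cos_sub]
  field_simp
  linear_combination (1 - n) * cos (σ + x) * cos (n * x) * sin_sq_add_cos_sq (n * x)

-- Divided by `cos (n * δ)`, the right-hand side increases with `δ`; at `δ = 0` equality holds.
theorem mul_sin_mul_cos_le {n σ δ : ℝ} (hn : 1 ≤ n) (hδ0 : 0 ≤ δ) (hδ : n * δ ≤ π / 2)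
    (h : ∀ x ∈ Icc 0 δ, cos (n * x) ≤ n * sin (σ + x)) :
    n * sin σ * cos (n * δ) ≤ (n - 1) * sin (σ + δ) + cos (n * δ) * sin (σ + δ - n * δ) := by
  have hn0 : 0 < n := by linarith
  rcases hδ.eq_or_lt with heq | hlt
  · have hend := h δ (right_mem_Icc.2 hδ0)
    rw [heq, cos_pi_div_two] at hend ⊢
    nlinarith [nonneg_of_mul_nonneg_right hend hn0]
  have hpos : ∀ x ∈ Icc 0 δ, 0 ≤ n * x ∧ n * x < π / 2 := fun x hx =>
    ⟨mul_nonneg hn0.le hx.1, (mul_le_mul_of_nonneg_left hx.2 hn0.le).trans_lt hlt⟩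
  have hcos : ∀ x ∈ Icc 0 δ, 0 < cos (n * x) := fun x hx =>
    cos_pos_of_mem_Ioo ⟨by linarith [(hpos x hx).1, pi_pos], (hpos x hx).2⟩
  have hmono : MonotoneOn
      (fun x => (n - 1) * sin (σ + x) / cos (n * x) + sin (σ + x - n * x)) (Icc 0 δ) := by
    refine monotoneOn_of_hasDerivWithinAt_nonneg (convex_Icc 0 δ)
      (fun x hx => (hasDerivAt_lobe (hcos x hx).ne').continuousAt.continuousWithinAt)
      (fun x hx => (hasDerivAt_lobe (hcos x (interior_subset hx)).ne').hasDerivWithinAt) ?_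
    intro x hx
    replace hx := interior_subset hx
    have hsin : 0 ≤ sin (n * x) :=
      sin_nonneg_of_nonneg_of_le_pi (hpos x hx).1 (by linarith [(hpos x hx).2, pi_pos])
    have hle : cos (n * x) * sin (σ + x - n * x) ≤ n * sin (σ + x) :=
      (mul_le_of_le_one_right (hcos x hx).le (sin_le_one _)).trans (h x hx)
    exact div_nonneg (mul_nonneg (mul_nonneg (sub_nonneg.2 hn) hsin) (sub_nonneg.2 hle))
      (sq_nonneg _)
  have hc := hcos δ (right_mem_Icc.2 hδ0)
  have hle := hmono (left_mem_Icc.2 hδ0) (right_mem_Icc.2 hδ0) hδ0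
  simp only [mul_zero, add_zero, sub_zero, cos_zero, div_one] at hle
  calc n * sin σ * cos (n * δ) = ((n - 1) * sin σ + sin σ) * cos (n * δ) := by ring
    _ ≤ ((n - 1) * sin (σ + δ) / cos (n * δ) + sin (σ + δ - n * δ)) * cos (n * δ) := by gcongr
    _ = (n - 1) * sin (σ + δ) + cos (n * δ) * sin (σ + δ - n * δ) := by field_simp

theorem sin_le_sin_of_le_of_add_le_pi {x y : ℝ} (hx : -(π / 2) ≤ x) (hxy : x ≤ y)
    (hadd : x + y ≤ π) : sin x ≤ sin y := by
  rw [← sub_nonneg, sin_sub_sin]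
  refine mul_nonneg (mul_nonneg two_pos.le (sin_nonneg_of_nonneg_of_le_pi ?_ ?_))
    (cos_nonneg_of_mem_Icc ⟨?_, ?_⟩) <;> linarith

theorem exists_cos_nat_mul_eq_zero_near {n : ℕ} (hn : n ≠ 0) {s : ℝ} (hs : s ∈ Ioo 0 π) :
    ∃ σ ∈ Icc (π / (2 * n)) (π - π / (2 * n)), cos (n * σ) = 0 ∧ |s - σ| ≤ π / (2 * n) := by
  have hn0 : (0 : ℝ) < n := by positivity
  have hns : 0 ≤ n * s / π := by have := hs.1; positivity
  obtain ⟨k, hk⟩ : ∃ k, k = ⌊n * s / π⌋₊ := ⟨_, rfl⟩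
  have hks : k * π / n ≤ s := by
    rw [div_le_iff₀' hn0, ← le_div_iff₀ pi_pos, hk]
    exact Nat.floor_le hns
  have hsk : s < (k + 1) * π / n := by
    rw [lt_div_iff₀' hn0, ← div_lt_iff₀ pi_pos, hk]
    exact Nat.lt_floor_add_one _
  have hkn : (k : ℝ) + 1 ≤ n := by
    have : k < n := by
      rw [hk, Nat.floor_lt hns, div_lt_iff₀ pi_pos]
      exact mul_lt_mul_of_pos_left hs.2 hn0
    exact_mod_cast this
  have hleft : k * π / n + π / (2 * n) = (2 * k + 1) * π / (2 * n) := by field_simp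
  have hright : (k + 1) * π / n - π / (2 * n) = (2 * k + 1) * π / (2 * n) := by
    field_simp
    ring
  have hk_nonneg : 0 ≤ k * π / n := by positivity
  have hk_le : (k + 1) * π / n ≤ π := by
    rw [div_le_iff₀ hn0, mul_comm π]
    gcongr
  refine ⟨(2 * k + 1) * π / (2 * n), ⟨by linarith, by linarith⟩,
    cos_eq_zero_iff.2 ⟨k, ?_⟩, abs_le.2 ⟨by linarith, by linarith⟩⟩
  push_cast
  field_simp

theorem abs_sin_eq_one_of_cos_eq_zero {x : ℝ} (hx : cos x = 0) : |sin x| = 1 := by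
  rw [← sqrt_sq_eq_abs, sin_sq, hx]
  simp

theorem mul_sin_mul_cos_le_of_cos_eq_zero {n : ℕ} (hn : n ≠ 0) {σ δ : ℝ}
    (hσ : σ ∈ Icc (π / (2 * n)) (π - π / (2 * n))) (hcos : cos (n * σ) = 0)
    (hδ : |δ| ≤ π / (2 * n)) :
    n * sin σ * cos (n * δ) ≤ (n - 1) * sin (σ + δ) + cos (n * δ) * sin (σ + δ - n * δ) := by
  -- The reflection `(σ, δ) ↦ (π - σ, -δ)` preserves both the hypotheses and the claim.
  wlog hδ0 : 0 ≤ δ generalizing σ δ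
  · have hreflect : cos (n * (π - σ)) = 0 := by
      rw [mul_sub, cos_nat_mul_pi_sub, hcos, mul_zero]
    have := this (σ := π - σ) (δ := -δ) ⟨by linarith [hσ.2], by linarith [hσ.1]⟩ hreflect
      (by rwa [abs_neg]) (by linarith)
    rwa [mul_neg, cos_neg, show π - σ + -δ = π - (σ + δ) by ring, sub_neg_eq_add, sin_pi_sub,
      sin_pi_sub, show π - (σ + δ) + n * δ = π - (σ + δ - n * δ) by ring, sin_pi_sub] at this
  have hn1 : (1 : ℝ) ≤ n := by exact_mod_cast Nat.one_le_iff_ne_zero.2 hn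
  have hδ_le := (abs_le.1 hδ).2
  refine mul_sin_mul_cos_le hn1 hδ0 ?_ fun x hx => ?_
  · calc n * δ ≤ n * (π / (2 * n)) := by gcongr
      _ = π / 2 := by field_simp
  · have hsin : 0 ≤ sin (σ + x) := by
      have : 0 < π / (2 * n) := by have := pi_pos; positivity
      exact sin_nonneg_of_nonneg_of_le_pi (by linarith [hσ.1, hx.1]) (by linarith [hσ.2, hx.2])
    calc cos (n * x) ≤ |sin (n * σ) * cos (n * x)| := by
          rw [abs_mul, abs_sin_eq_one_of_cos_eq_zero hcos, one_mul]
          exact le_abs_self _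
      _ = |sin (n * (σ + x))| := by rw [mul_add, sin_add, hcos, zero_mul, add_zero]
      _ ≤ n * sin (σ + x) := by
          rw [← abs_of_nonneg hsin]
          simpa using abs_sin_nat_mul_le n (σ + x)

theorem mul_sin_mul_abs_sin_le {n : ℕ} (hn : n ≠ 0) {s : ℝ} (hs : s ∈ Ioo 0 π) :
    n * sin (π / (2 * n)) * |sin (n * s)| ≤
      (n - 1) * sin s + sin (n * s) * cos ((n - 1) * s) := by
  obtain ⟨σ, hσ, hcos, hsσ⟩ := exists_cos_nat_mul_eq_zero_near hn hs
  obtain ⟨δ, rfl⟩ : ∃ δ, s = σ + δ := ⟨s - σ, by ring⟩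
  rw [add_sub_cancel_left] at hsσ
  have hpi : 0 < π / (2 * n) := div_pos pi_pos (by positivity)
  have hnδ : |n * δ| ≤ π / 2 := by
    calc |n * δ| = n * |δ| := by rw [abs_mul, Nat.abs_cast]
      _ ≤ n * (π / (2 * n)) := by gcongr
      _ = π / 2 := by field_simp
  have hcos_nonneg : 0 ≤ cos (n * δ) := cos_nonneg_of_mem_Icc (abs_le.1 hnδ)
  have habs := abs_sin_eq_one_of_cos_eq_zero hcos
  have hsin : sin (n * (σ + δ)) = sin (n * σ) * cos (n * δ) := by
    rw [mul_add, sin_add, hcos, zero_mul, add_zero]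
  have hcos_pred : cos ((n - 1) * (σ + δ)) = sin (n * σ) * sin (σ + δ - n * δ) := by
    rw [show (n - 1) * (σ + δ) = n * σ - (σ + δ - n * δ) by ring, cos_sub, hcos, zero_mul, zero_add]
  calc n * sin (π / (2 * n)) * |sin (n * (σ + δ))|
      = n * sin (π / (2 * n)) * cos (n * δ) := by
        rw [hsin, abs_mul, habs, one_mul, abs_of_nonneg hcos_nonneg]
    _ ≤ n * sin σ * cos (n * δ) := by
        gcongr
        exact sin_le_sin_of_le_of_add_le_pi (by linarith [pi_pos]) hσ.1 (by linarith [hσ.2])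
    _ ≤ (n - 1) * sin (σ + δ) + cos (n * δ) * sin (σ + δ - n * δ) :=
        mul_sin_mul_cos_le_of_cos_eq_zero hn hσ hcos hsσ
    _ = (n - 1) * sin (σ + δ) + |sin (n * σ)| ^ 2 * (cos (n * δ) * sin (σ + δ - n * δ)) := by
        rw [habs, one_pow, one_mul]
    _ = (n - 1) * sin (σ + δ) + sin (n * (σ + δ)) * cos ((n - 1) * (σ + δ)) := by
        rw [sq_abs, hsin, hcos_pred]
        ring

theorem U_two_mul_mul_sin (T : ℕ) (θ : ℝ) :
    (U ℝ (2 * T)).eval (cos θ) * sin θ = 2 * sin ((T + 1) * θ) * cos (T * θ) - sin θ := by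
  have hU := U_real_cos θ (2 * T)
  push_cast at hU
  have hsum : sin ((2 * T + 1) * θ) = sin ((T + 1) * θ + T * θ) := by congr 1; ring
  have hdiff : sin θ = sin ((T + 1) * θ - T * θ) := by congr 1; ring
  rw [hU, hsum, sin_add, hdiff, sin_sub]
  ring

theorem cornerA_eq (T : ℕ) : cornerA T = (1 + cornerB T) * sin (π / (2 + 2 * T)) := by
  rw [cornerA, cornerB]
  field_simp
  ring

theorem sin_pi_div_mem_Ioo {T : ℕ} (hT : T ≠ 0) : sin (π / (2 + 2 * T)) ∈ Ioo 0 1 := by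
  have hT1 : (1 : ℝ) ≤ T := by exact_mod_cast Nat.one_le_iff_ne_zero.2 hT
  have hlt : π / (2 + 2 * T) < π / 2 := by gcongr; linarith
  have hpos : 0 < π / (2 + 2 * T) := div_pos pi_pos (by positivity)
  refine ⟨sin_pos_of_pos_of_lt_pi hpos (by linarith [pi_pos]), ?_⟩
  rw [← sin_pi_div_two]
  exact sin_lt_sin_of_lt_of_le_pi_div_two (by linarith [pi_pos]) le_rfl hlt

theorem cornerB_pos (T : ℕ) : 0 < cornerB T := by
  rw [cornerB]
  positivity

theorem cornerB_mul_eval_U_le (T : ℕ) {x : ℝ} (hx : x ∈ Icc (-1) 1) :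
    cornerB T * (U ℝ (2 * T)).eval x ≤ 1 := by
  have hU := (le_abs_self _).trans (abs_eval_U_le (2 * T) hx)
  push_cast at hU
  rw [cornerB, one_div, inv_mul_le_iff₀ (by positivity)]
  linarith

theorem abs_cornerA_mul_eval_U_le (T : ℕ) {x : ℝ} (hx : x ∈ Icc (-1) 1) :
    |cornerA T * (U ℝ T).eval x| ≤ 1 + cornerB T * (U ℝ (2 * T)).eval x := by
  refine le_on_Icc_of_comp_cos_le (f := fun x => |cornerA T * (U ℝ T).eval x|)
    (g := fun x => 1 + cornerB T * (U ℝ (2 * T)).eval x) (by fun_prop) (by fun_prop)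
    (fun θ hθ => ?_) hx
  have hsin := sin_pos_of_mem_Ioo hθ
  have hU := U_real_cos θ T
  push_cast at hU
  have hA : 0 ≤ cornerA T := by
    have : 0 ≤ sin (π / (2 + 2 * T)) := sin_nonneg_of_nonneg_of_le_pi (by positivity)
      (div_le_self pi_pos.le (by linarith [T.cast_nonneg (α := ℝ)]))
    rw [cornerA]
    positivity
  have hmain := mul_sin_mul_abs_sin_le T.succ_ne_zero hθ
  rw [Nat.cast_succ, add_sub_cancel_right, show 2 * ((T : ℝ) + 1) = 2 + 2 * T by ring] at hmain
  refine le_of_mul_le_mul_right ?_ hsin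
  calc |cornerA T * (U ℝ T).eval (cos θ)| * sin θ
      = cornerA T * |sin ((T + 1) * θ)| := by
        rw [abs_mul, abs_of_nonneg hA, ← hU, abs_mul, abs_of_pos hsin, mul_assoc]
    _ = 2 / (1 + 2 * T) * ((T + 1) * sin (π / (2 + 2 * T)) * |sin ((T + 1) * θ)|) := by
        rw [cornerA]
        ring
    _ ≤ 2 / (1 + 2 * T) * (T * sin θ + sin ((T + 1) * θ) * cos (T * θ)) := by gcongr
    _ = (1 + cornerB T * (U ℝ (2 * T)).eval (cos θ)) * sin θ := by
        rw [add_mul 1, mul_assoc (cornerB T), U_two_mul_mul_sin, cornerB]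
        field_simp
        ring

theorem corner_mem_univalenceRegion {T : ℕ} (hT : T ≠ 0) : corner T ∈ univalenceRegion T :=
  (mem_univalenceRegion_iff hT).2 fun _ hx =>
    ⟨cornerB_mul_eval_U_le T hx, abs_cornerA_mul_eval_U_le T hx⟩

namespace univalenceRegion

variable {T : ℕ} {p : ℝ × ℝ}

theorem snd_le_cornerB (hT : T ≠ 0) (hp : p ∈ univalenceRegion T) : p.2 ≤ cornerB T := by
  have hone := ((mem_univalenceRegion_iff hT).1 hp 1 (by simp)).1
  rw [U_eval_one] at hone
  push_cast at hone
  rw [cornerB, le_div_iff₀ (by positivity)]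
  linarith

theorem abs_fst_le (hT : T ≠ 0) (hp : p ∈ univalenceRegion T) :
    |p.1| ≤ (1 + p.2) * sin (π / (2 + 2 * T)) := by
  obtain ⟨θ, hθ⟩ : ∃ θ, θ = π / (2 + 2 * T) := ⟨_, rfl⟩
  have hsin : 0 < sin θ := hθ ▸ (sin_pi_div_mem_Ioo hT).1
  have hmid : (U ℝ T).eval (cos θ) * sin θ = 1 := by
    have hangle : (T + 1) * θ = π / 2 := by
      rw [hθ]
      field_simp
      ring
    rw [U_real_cos, Int.cast_natCast, hangle, sin_pi_div_two]
  have htop : (U ℝ (2 * T)).eval (cos θ) = 1 := by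
    have hangle : (2 * T + 1) * θ = π - θ := by
      rw [hθ]
      field_simp
      ring
    refine mul_right_cancel₀ hsin.ne' ?_
    rw [U_real_cos, Int.cast_mul, Int.cast_ofNat, Int.cast_natCast, hangle, sin_pi_sub, one_mul]
  have hle := ((mem_univalenceRegion_iff hT).1 hp _ ⟨neg_one_le_cos θ, cos_le_one θ⟩).2
  rw [htop, mul_one] at hle
  calc |p.1| = |p.1 * (U ℝ T).eval (cos θ) * sin θ| := by rw [mul_assoc, hmid, mul_one]
    _ = |p.1 * (U ℝ T).eval (cos θ)| * sin θ := by rw [abs_mul _ (sin θ), abs_of_pos hsin]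
    _ ≤ (1 + p.2) * sin (π / (2 + 2 * T)) := by rw [← hθ]; gcongr

theorem neg_one_lt_snd (hT : T ≠ 0) (hp : p ∈ univalenceRegion T) : -1 < p.2 := by
  have hone := (abs_nonneg _).trans ((mem_univalenceRegion_iff hT).1 hp 1 (by simp)).2
  rw [U_eval_one] at hone
  push_cast at hone
  have hT1 : (1 : ℝ) ≤ T := by exact_mod_cast Nat.one_le_iff_ne_zero.2 hT
  nlinarith

theorem fst_le_cornerA (hT : T ≠ 0) (hp : p ∈ univalenceRegion T) : p.1 ≤ cornerA T := by
  calc p.1 ≤ (1 + p.2) * sin (π / (2 + 2 * T)) := (le_abs_self _).trans (abs_fst_le hT hp)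
    _ ≤ (1 + cornerB T) * sin (π / (2 + 2 * T)) := by
        gcongr
        · exact (sin_pi_div_mem_Ioo hT).1.le
        · exact snd_le_cornerB hT hp
    _ = cornerA T := (cornerA_eq T).symm

theorem one_add_fst_add_snd_pos (hT : T ≠ 0) (hp : p ∈ univalenceRegion T) :
    0 < 1 + p.1 + p.2 := by
  have hlt : (1 + p.2) * sin (π / (2 + 2 * T)) < 1 + p.2 :=
    mul_lt_of_lt_one_right (by linarith [neg_one_lt_snd hT hp]) (sin_pi_div_mem_Ioo hT).2
  linarith [neg_abs_le p.1, abs_fst_le hT hp]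

theorem L₃_corner_le (hT : T ≠ 0) (hp : p ∈ univalenceRegion T) : L₃ (corner T) ≤ L₃ p := by
  have hcorner := one_add_fst_add_snd_pos hT (corner_mem_univalenceRegion hT)
  have hratio : p.1 * (1 + cornerB T) ≤ cornerA T * (1 + p.2) := by
    calc p.1 * (1 + cornerB T) ≤ (1 + p.2) * sin (π / (2 + 2 * T)) * (1 + cornerB T) := by
          gcongr
          · linarith [cornerB_pos T]
          · exact (le_abs_self _).trans (abs_fst_le hT hp)
      _ = cornerA T * (1 + p.2) := by rw [cornerA_eq]; ring
  rw [L₃, L₃, div_le_div_iff₀ hcorner (one_add_fst_add_snd_pos hT hp)]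
  simp only [corner]
  linarith

end univalenceRegion

theorem theorem1 (T : ℕ) (hT : 1 ≤ T) :
    -- the corner is a point of the region
    corner T ∈ univalenceRegion T ∧
    -- and it is the upper right corner of the region
    (∀ p ∈ univalenceRegion T, p.1 ≤ (corner T).1 ∧ p.2 ≤ (corner T).2) ∧
    -- the quotient defining `L₃` makes sense on the whole region
    (∀ p ∈ univalenceRegion T, 0 < 1 + p.1 + p.2) ∧
    IsMaxOn L₁ (univalenceRegion T) (corner T) ∧
    IsMaxOn L₂ (univalenceRegion T) (corner T) ∧
    IsMinOn L₃ (univalenceRegion T) (corner T) := by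
  have hT0 : T ≠ 0 := Nat.one_le_iff_ne_zero.1 hT
  have hle : ∀ p ∈ univalenceRegion T, p.1 ≤ (corner T).1 ∧ p.2 ≤ (corner T).2 :=
    fun p hp => ⟨univalenceRegion.fst_le_cornerA hT0 hp, univalenceRegion.snd_le_cornerB hT0 hp⟩
  have hL₂ : ∀ p ∈ univalenceRegion T, L₂ p ≤ L₂ (corner T) := fun p hp =>
    add_le_add (add_le_add_right (hle p hp).1 1) (hle p hp).2
  exact ⟨corner_mem_univalenceRegion hT0, hle,
    fun p hp => univalenceRegion.one_add_fst_add_snd_pos hT0 hp, fun p hp => (hle p hp).1, hL₂,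
    fun p hp => univalenceRegion.L₃_corner_le hT0 hp⟩
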